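/- Fix integers $1\le p\le q$ and let $\mathrm{Gr}_{p,q}$ be the set of all $p$-dimensional linear subspaces of the Euclidean space $\mathbb R^{p+q}$. For $L,M\in\mathrm{Gr}_{p,q}$ let $\lambda_1\ge\dots\ge\lambda_p$ be the singular values of the matrix of scalar products of an orthonormal basis of $L$ with an orthonormal basis of $M$ (they do not depend on the bases), and let $\Psi[L,M]=(\Psi_1,\dots,\Psi_p)$ with $\Psi_j[L,M]=\arccos\lambda_j$ be the Jordan angles. Let $W_p$ be the group of transformations of $\mathbb R^p$ generated by the permutations and the sign changes of the coordinates. An H-curve with invariants $0\le a_1\le\dots\le a_p$ is a curve $\gamma:\mathbb R\to\mathrm{Gr}_{p,q}$ that has the form $$\gamma(s)=L_a(s)=\mathrm{span}\{\cos(a_js)e_j+\sin(a_js)f_j:\ 1\le j\le p\}$$ for some orthonormal basis $e_1,\dots,e_p,f_1,\dots,f_p,r_1,\dots,r_{q-p}$ of $\mathbb R^{p+q}$. Its points $\gamma(s),\gamma(t)$ are called sufficiently near if $a_p|s-t|\le\pi/2$. (1) Let $\gamma$ be an H-curve and $s_1<s_2<s_3$ be such that $\gamma(s_1),\gamma(s_2),\gamma(s_3)$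 are pairwise sufficiently near. Then for all $j$ $$\Psi_j[\gamma(s_1),\gamma(s_2)]+\Psi_j[\gamma(s_2),\gamma(s_3)]=\Psi_j[\gamma(s_1),\gamma(s_3)].$$ (2) Let $\ell$ be a $W_p$-invariant norm on $\mathbb R^p$. Then $d(L,M)=\ell(\Psi[L,M])$ is a metric on $\mathrm{Gr}_{p,q}$, and every H-curve $\gamma$ is a geodesic of this metric: it is parametrized with constant speed and is, near every value of the parameter, a shortest curve between its points that realizes the distance. More precisely, if $a$ are the invariants of $\gamma$, $s\le t$, and $\gamma(s),\gamma(t)$ are sufficiently near, then $d(\gamma(u),\gamma(v))=\ell(a)\,|u-v|$ for all $u,v\in[s,t]$, and no $d$-continuous curve from $\gamma(s)$ to $\gamma(t)$ is shorter than $\gamma|_{[s,t]}$, where the length of a curve is the supremum of the lengths of inscribed polygons. -/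

import Mathlib

noncomputable section

namespace JordanAngles

/-- Euclidean space of dimension `p + q`. -/
abbrev Euc (p q : ℕ) : Type := EuclideanSpace ℝ (Fin (p + q))

/-- The Grassmannian of `p`-dimensional linear subspaces of Euclidean `(p + q)`-space. -/
def Gr (p q : ℕ) : Type :=
  {L : Submodule ℝ (Euc p q) // Module.finrank ℝ L = p}

/-- An orthonormal basis of a point of the Grassmannian, indexed by `Fin p`. -/
def onb {p q : ℕ} (L : Gr p q) : OrthonormalBasis (Fin p) ℝ L.1 :=
  (stdOrthonormalBasis ℝ L.1).reindex (finCongr L.2)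

/-- The matrix of scalar products of a family `e` with a family `f`. -/
def crossGram {p q : ℕ} (e f : Fin p → Euc p q) : Matrix (Fin p) (Fin p) ℝ :=
  Matrix.of fun i j => inner ℝ (e i) (f j)

/-- The singular values of a real square matrix in decreasing order. -/
def matrixSingularValue {p : ℕ} (A : Matrix (Fin p) (Fin p) ℝ) (j : Fin p) : ℝ :=
  (Matrix.toEuclideanLin A).singularValues j

/-- The singular values of the matrix of scalar products of an orthonormal basis of `L` with an
orthonormal basis of `M`, in decreasing order. -/
def cosAngle {p q : ℕ} (L M : Gr p q) (j : Fin p) : ℝ :=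
  matrixSingularValue (crossGram (fun i => (onb L i : Euc p q)) (fun i => (onb M i : Euc p q))) j

theorem singularValues_comp_isometries {E F E' F' : Type*}
    [NormedAddCommGroup E] [InnerProductSpace ℝ E] [FiniteDimensional ℝ E]
    [NormedAddCommGroup F] [InnerProductSpace ℝ F] [FiniteDimensional ℝ F]
    [NormedAddCommGroup E'] [InnerProductSpace ℝ E'] [FiniteDimensional ℝ E']
    [NormedAddCommGroup F'] [InnerProductSpace ℝ F'] [FiniteDimensional ℝ F']
    (T : E →ₗ[ℝ] F) (T' : E' →ₗ[ℝ] F') (U : E ≃ₗᵢ[ℝ] E') (V : F ≃ₗᵢ[ℝ] F')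
    (h : ∀ x, T' (U x) = V (T x)) (j : ℕ) :
    T'.singularValues j = T.singularValues j := by
  have hd : Module.finrank ℝ E = Module.finrank ℝ E' := U.toLinearEquiv.finrank_eq
  by_cases hj : j < Module.finrank ℝ E
  · rw [T.singularValues_of_lt rfl hj, T'.singularValues_of_lt hd.symm hj]
    have key : LinearMap.adjoint T' ∘ₗ T' =
        U.toLinearEquiv.conj (LinearMap.adjoint T ∘ₗ T) := by
      ext x
      refine ext_inner_right ℝ fun y => ?_
      obtain ⟨x, rfl⟩ := U.surjective x
      obtain ⟨y, rfl⟩ := U.surjective y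
      have : U.toLinearEquiv.conj (LinearMap.adjoint T ∘ₗ T) (U x) =
          U ((LinearMap.adjoint T ∘ₗ T) x) := by
        simp [LinearEquiv.conj_apply]
      rw [this, U.inner_map_map]
      simp [LinearMap.adjoint_inner_left, h]
    have := (LinearMap.IsSymmetric.eigenvalues_eq_eigenvalues_iff
      T'.isSymmetric_adjoint_comp_self hd.symm T.isSymmetric_adjoint_comp_self rfl).mpr (by
        rw [key, LinearEquiv.charpoly_conj])
    rw [this]
  · rw [T.singularValues_of_finrank_le (by omega), T'.singularValues_of_finrank_le (by omega)]

/-- The singular values do not depend on the choice of the orthonormal bases. -/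
theorem matrixSingularValue_crossGram {p q : ℕ} (L M : Gr p q)
    (e : OrthonormalBasis (Fin p) ℝ L.1) (f : OrthonormalBasis (Fin p) ℝ M.1) (j : Fin p) :
    matrixSingularValue (crossGram (fun i => (e i : Euc p q)) (fun i => (f i : Euc p q))) j =
      cosAngle L M j := by
  have main : ∀ (e : OrthonormalBasis (Fin p) ℝ L.1) (f : OrthonormalBasis (Fin p) ℝ M.1),
      matrixSingularValue (crossGram (fun i => (e i : Euc p q)) (fun i => (f i : Euc p q))) j =
        (L.1.orthogonalProjectionOnto.toLinearMap ∘ₗ M.1.subtype).singularValues j := by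
    intro e f
    refine singularValues_comp_isometries _ _ f.repr e.repr (fun x => ?_) j
    ext i
    rw [e.repr_apply_apply]
    simp only [Matrix.toLpLin_apply, Matrix.mulVec, dotProduct, crossGram, Matrix.of_apply,
      f.repr_apply_apply]
    have h2 : inner ℝ (e i) ((L.1.orthogonalProjectionOnto.toLinearMap ∘ₗ M.1.subtype) x) =
        inner ℝ (e i : Euc p q) (x : Euc p q) := by
      simp
    rw [h2]
    have h3 : (x : Euc p q) = ∑ k, inner ℝ (f k) x • (f k : Euc p q) := by
      conv_lhs => rw [← f.sum_repr' x]
      simp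
    conv_rhs => rw [h3, inner_sum]
    refine Finset.sum_congr rfl fun k _ => ?_
    rw [real_inner_smul_right, mul_comm]
  rw [cosAngle, main e f, main (onb L) (onb M)]

/-- The Jordan angles between `L` and `M`, in increasing order. -/
def angle {p q : ℕ} (L M : Gr p q) (j : Fin p) : ℝ :=
  Real.arccos (cosAngle L M j)

/-- The group generated by the permutations of the coordinates and by the changes of signs of the
coordinates. -/
def weylGroup (p : ℕ) : Subgroup ((Fin p → ℝ) ≃ₗ[ℝ] (Fin p → ℝ)) :=
  Subgroup.closure
    ({g | ∃ τ : Equiv.Perm (Fin p), ∀ x j, g x j = x (τ j)} ∪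
      {g | ∃ σ : Fin p → ℝ, (∀ j, σ j = 1 ∨ σ j = -1) ∧ ∀ x j, g x j = σ j * x j})

/-- A seminorm on `ℝ^p` that is a norm and is invariant under the Weyl group. -/
structure IsWeylInvariantNorm {p : ℕ} (l : Seminorm ℝ (Fin p → ℝ)) : Prop where
  eq_zero : ∀ x, l x = 0 → x = 0
  invariant : ∀ g ∈ weylGroup p, ∀ x, l (g x) = l x

/-- Orthonormal bases `e₁, …, e_p, f₁, …, f_p, r₁, …, r_{q-p}` of Euclidean `(p + q)`-space. -/
abbrev AdaptedBasis (p q : ℕ) : Type :=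
  OrthonormalBasis (Fin p ⊕ Fin p ⊕ Fin (q - p)) ℝ (Euc p q)

/-- The vectors `cos (a_j s) e_j + sin (a_j s) f_j`. -/
def hVector {p q : ℕ} (b : AdaptedBasis p q) (a : Fin p → ℝ) (s : ℝ) (j : Fin p) : Euc p q :=
  Real.cos (a j * s) • b (Sum.inl j) + Real.sin (a j * s) • b (Sum.inr (Sum.inl j))

theorem orthonormal_hVector {p q : ℕ} (b : AdaptedBasis p q) (a : Fin p → ℝ) (s : ℝ) :
    Orthonormal ℝ (hVector b a s) := by
  rw [orthonormal_iff_ite]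
  intro i j
  have hb := orthonormal_iff_ite.mp b.orthonormal
  by_cases hij : i = j
  · subst hij
    simp only [hVector, inner_add_left, inner_add_right, real_inner_smul_left,
      real_inner_smul_right, hb]
    simp
    nlinarith [Real.sin_sq_add_cos_sq (a i * s)]
  · simp only [hVector, inner_add_left, inner_add_right, real_inner_smul_left,
      real_inner_smul_right, hb]
    simp [hij]

/-- The curve `s ↦ span {cos (a_j s) e_j + sin (a_j s) f_j}` in the Grassmannian. -/
def hCurve {p q : ℕ} (b : AdaptedBasis p q) (a : Fin p → ℝ) (s : ℝ) : Gr p q :=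
  ⟨Submodule.span ℝ (Set.range (hVector b a s)), by
    rw [finrank_span_eq_card (orthonormal_hVector b a s).linearIndependent, Fintype.card_fin]⟩

/-- `γ` is an H-curve with invariants `0 ≤ a₁ ≤ … ≤ a_p`. -/
structure IsHCurve {p q : ℕ} (γ : ℝ → Gr p q) (a : Fin p → ℝ) : Prop where
  nonneg : ∀ j, 0 ≤ a j
  mono : Monotone a
  eq_hCurve : ∃ b : AdaptedBasis p q, γ = hCurve b a

/-- The parameters `s`, `t` belong to sufficiently near points of an H-curve with invariants `a`:
the largest invariant times `|s - t|` is at most `π / 2`. -/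
def SufficientlyNear {p : ℕ} (a : Fin p → ℝ) (s t : ℝ) : Prop :=
  ∀ j, a j * |s - t| ≤ Real.pi / 2

/-- On `[s, t]` the curve `γ` is a minimal geodesic of constant speed `c`: distances between its
points are `c` times the differences of the parameters, and no continuous curve with the same end
points is shorter. The length of a curve is its variation, that is, the supremum of the lengths of
inscribed polygons. -/
structure IsMinimalGeodesicOn {X : Type*} [MetricSpace X] (γ : ℝ → X) (c s t : ℝ) : Prop where
  dist_eq : ∀ u ∈ Set.Icc s t, ∀ v ∈ Set.Icc s t, dist (γ u) (γ v) = c * |u - v|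
  shortest : ∀ (δ : ℝ → X) (x y : ℝ), x ≤ y → ContinuousOn δ (Set.Icc x y) →
    δ x = γ s → δ y = γ t →
    eVariationOn γ (Set.Icc s t) ≤ eVariationOn δ (Set.Icc x y)

/-- `γ` is a geodesic of a metric space: with some constant speed, it is a minimal geodesic near
every value of the parameter. -/
def IsGeodesic {X : Type*} [MetricSpace X] (γ : ℝ → X) : Prop :=
  ∃ c : ℝ, 0 ≤ c ∧ ∀ r : ℝ, ∃ ε : ℝ, 0 < ε ∧ IsMinimalGeodesicOn γ c (r - ε) (r + ε)

end JordanAngles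

end

noncomputable section

namespace JordanAngles

open Module Submodule
open scoped RealInnerProductSpace

/-! ### Principal vectors of a pair of subspaces -/

section Principal

variable {E : Type*} [NormedAddCommGroup E] [InnerProductSpace ℝ E]

/-! Between sufficiently near points of an H-curve the rotating vectors are principal vectors, so
the Jordan angles are `a j * |s - t|` (`IsHCurve.angle_eq`). Additivity and constant speed follow,
and the triangle inequality makes curves of constant speed shortest. All the weight thus lies on the
triangle inequality for `l (angle L M)`.

It reduces to the sums of the `k` largest angles (`sum_angle_natAdd_le`). Hahn–Banach and
rearrangement give `l` a norming functional at the increasing vector `angle L N` with nonnegative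
increasing coefficients; Abel summation writes such a functional as a nonnegative combination of
these tail sums.

For the tail sums, let `Y ⊆ L` be spanned by the `k` principal vectors farthest from `N`, and rotate
`M` into `N` with the Jordan angles as velocities. The angle sum between `Y` and the moving subspace
is a minimum over pairs of orthonormal frames, so carrying along the optimal frame bounds it from
above by a smooth function touching it. The derivative of that function is at most the sum of the
`k` largest velocities (`first_variation_le`). At the start, interlacing bounds the angle sum by the
`k` largest angles between `L` and `M`. Since `arccos` is not differentiable at `1`, all cosines are
first multiplied by `c < 1`, and then `c` tends to `1`. -/

theorem exists_orthonormal_extension [FiniteDimensional ℝ E] {ι : Type*} [Fintype ι]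
    (hc : Fintype.card ι ≤ finrank ℝ E) (v : ι → E) (s : Set ι)
    (hn : ∀ i ∈ s, ‖v i‖ = 1) (ho : ∀ i ∈ s, ∀ j ∈ s, i ≠ j → ⟪v i, v j⟫ = 0) :
    ∃ u : ι → E, Orthonormal ℝ u ∧ ∀ i ∈ s, u i = v i := by
  have hcard : finrank ℝ E = Fintype.card (ι ⊕ Fin (finrank ℝ E - Fintype.card ι)) := by
    simp; omega
  have hv : Orthonormal ℝ ((Sum.inl '' s : Set (ι ⊕ Fin (finrank ℝ E - Fintype.card ι))).domRestrict
      (Sum.elim v fun _ => 0)) := by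
    constructor
    · rintro ⟨_, i, hi, rfl⟩
      exact hn i hi
    · rintro ⟨_, i, hi, rfl⟩ ⟨_, j, hj, rfl⟩ hij
      exact ho i hi j hj fun h => hij (by subst h; rfl)
  obtain ⟨b, hb⟩ := hv.exists_orthonormalBasis_extension_of_card_eq hcard
  exact ⟨fun i => b (Sum.inl i), b.orthonormal.comp _ Sum.inl_injective,
    fun i hi => hb _ ⟨i, hi, rfl⟩⟩

theorem exists_orthonormal_extension_mem {ι : Type*} [Fintype ι] (X : Submodule ℝ E)
    [FiniteDimensional ℝ X] (hc : Fintype.card ι ≤ finrank ℝ X) (v : ι → E) (s : Set ι)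
    (hn : ∀ i ∈ s, ‖v i‖ = 1) (ho : ∀ i ∈ s, ∀ j ∈ s, i ≠ j → ⟪v i, v j⟫ = 0)
    (hX : ∀ i, v i ∈ X) :
    ∃ u : ι → E, Orthonormal ℝ u ∧ (∀ i, u i ∈ X) ∧ ∀ i ∈ s, u i = v i := by
  obtain ⟨u, hu, hs⟩ := exists_orthonormal_extension hc (fun i => (⟨v i, hX i⟩ : X)) s hn ho
  exact ⟨fun i => u i, hu.comp_linearIsometry X.subtypeₗᵢ, fun i => (u i).2,
    fun i hi => congrArg Subtype.val (hs i hi)⟩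

/-- Singular value decomposition of the orthogonal projection from `Y` to `X`: principal vectors
`y i` of `Y` and `x i` of `X` with the cosines `σ i` of the angles between them. -/
structure IsPrincipal {k : ℕ} (Y X : Submodule ℝ E) (y x : Fin k → E) (σ : Fin k → ℝ) : Prop where
  left_orthonormal : Orthonormal ℝ y
  right_orthonormal : Orthonormal ℝ x
  span_left : span ℝ (Set.range y) = Y
  right_mem : ∀ i, x i ∈ X
  inner_eq : ∀ i, ∀ v ∈ X, ⟪y i, v⟫ = σ i * ⟪x i, v⟫
  nonneg : ∀ i, 0 ≤ σ i
  antitone : Antitone σ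

/-- The orthogonal projection from `Y` to `X`. -/
def projMap (Y X : Submodule ℝ E) [X.HasOrthogonalProjection] : Y →ₗ[ℝ] X :=
  X.orthogonalProjectionOnto.toLinearMap ∘ₗ Y.subtype

theorem inner_projMap (Y X : Submodule ℝ E) [X.HasOrthogonalProjection] (y : Y) (v : X) :
    ⟪projMap Y X y, v⟫ = ⟪(y : E), (v : E)⟫ := by
  simp [projMap]

/-- Eigenvectors of `T* T` have orthogonal images of length equal to the singular values.
Normalizing the nonzero images gives part of `x`; where the singular value vanishes, any orthonormal
completion serves. -/
theorem exists_isPrincipal {k : ℕ} (Y X : Submodule ℝ E) [FiniteDimensional ℝ Y]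
    [FiniteDimensional ℝ X] (hY : finrank ℝ Y = k) (hX : k ≤ finrank ℝ X) :
    ∃ y x : Fin k → E, IsPrincipal Y X y x fun i => (projMap Y X).singularValues i := by
  set T := projMap Y X
  set e := T.isSymmetric_adjoint_comp_self.eigenvectorBasis hY
  have hT : ∀ i j, ⟪T (e i), T (e j)⟫ = if i = j then T.singularValues i ^ 2 else 0 := by
    intro i j
    rw [← LinearMap.adjoint_inner_left, ← LinearMap.comp_apply,
      T.isSymmetric_adjoint_comp_self.apply_eigenvectorBasis hY, RCLike.ofReal_real_eq_id, id,
      real_inner_smul_left, orthonormal_iff_ite.mp e.orthonormal, T.sq_singularValues_fin hY]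
    simp
  have hT0 : ∀ i : Fin k, T.singularValues i = 0 → T (e i) = 0 := by
    intro i hi
    have := hT i i
    rw [if_pos rfl, hi] at this
    simpa using this
  obtain ⟨x, hx, hxs⟩ := exists_orthonormal_extension (E := X) (ι := Fin k) (by simpa using hX)
    (fun i => (T.singularValues i)⁻¹ • T (e i)) {i | T.singularValues i ≠ 0}
    (by
      intro i hi
      have h1 : ‖T (e i)‖ ^ 2 = T.singularValues i ^ 2 := by
        rw [← real_inner_self_eq_norm_sq, hT, if_pos rfl]
      have h2 : ‖T (e i)‖ = T.singularValues i :=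
        (sq_eq_sq₀ (norm_nonneg _) (T.singularValues_nonneg i)).mp h1
      rw [norm_smul, h2, norm_inv, Real.norm_of_nonneg (T.singularValues_nonneg i)]
      exact inv_mul_cancel₀ hi)
    (by
      intro i _ j _ hij
      rw [real_inner_smul_left, real_inner_smul_right, hT, if_neg hij, mul_zero, mul_zero])
  have hTx : ∀ i : Fin k, T (e i) = T.singularValues i • x i := by
    intro i
    by_cases hi : T.singularValues i = 0
    · rw [hT0 i hi, hi, zero_smul]
    · rw [hxs i hi, smul_smul, mul_inv_cancel₀ hi, one_smul]
  refine ⟨fun i => e i, fun i => x i, e.orthonormal.comp_linearIsometry Y.subtypeₗᵢ,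
    hx.comp_linearIsometry X.subtypeₗᵢ, ?_, fun i => (x i).2, ?_,
    fun i => T.singularValues_nonneg i, fun i j hij => T.singularValues_antitone hij⟩
  · have : Set.range (fun i => (e i : E)) = Y.subtype '' Set.range e := by
      rw [← Set.range_comp]; rfl
    rw [this, ← map_span, ← OrthonormalBasis.coe_toBasis, e.toBasis.span_eq]
    simp
  · intro i v hv
    rw [← inner_projMap Y X (e i) ⟨v, hv⟩]
    change ⟪T (e i), _⟫ = _
    rw [hTx, real_inner_smul_left]
    rfl

theorem eq_sum_inner_of_mem_span {k : ℕ} {y : Fin k → E} (hy : Orthonormal ℝ y) {z : E}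
    (hz : z ∈ span ℝ (Set.range y)) : z = ∑ j, ⟪y j, z⟫ • y j := by
  obtain ⟨c, rfl⟩ := (mem_span_range_iff_exists_fun ℝ).mp hz
  refine Finset.sum_congr rfl fun j _ => ?_
  rw [hy.inner_right_fintype]

theorem inner_eq_sum_of_mem_span {k : ℕ} {y : Fin k → E} (hy : Orthonormal ℝ y) {z : E}
    (hz : z ∈ span ℝ (Set.range y)) (v : E) : ⟪z, v⟫ = ∑ j, ⟪y j, z⟫ * ⟪y j, v⟫ := by
  conv_lhs => rw [eq_sum_inner_of_mem_span hy hz, sum_inner]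
  simp [real_inner_smul_left]

theorem sum_inner_sq_of_mem_span {k : ℕ} {y : Fin k → E} (hy : Orthonormal ℝ y) {z : E}
    (hz : z ∈ span ℝ (Set.range y)) : ∑ j, ⟪y j, z⟫ ^ 2 = ‖z‖ ^ 2 := by
  rw [← real_inner_self_eq_norm_sq, inner_eq_sum_of_mem_span hy hz]
  simp [sq]

theorem sum_inner_sq_le {ι : Type*} [Fintype ι] {y : ι → E} (hy : Orthonormal ℝ y) (z : E) :
    ∑ j, ⟪y j, z⟫ ^ 2 ≤ ‖z‖ ^ 2 := by
  simpa using hy.sum_inner_products_le z (s := Finset.univ)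

theorem finrank_span_orthonormal {ι : Type*} {y : ι → E} (hy : Orthonormal ℝ y) (s : Finset ι) :
    finrank ℝ (span ℝ (y '' s)) = s.card := by
  rw [Set.image_eq_range]
  have h := hy.comp (fun i : (s : Set ι) => (i : ι)) Subtype.val_injective
  have := finrank_span_eq_card h.linearIndependent
  simpa [Function.comp_def] using this

theorem inner_eq_zero_of_mem_span_image {ι : Type*} {y : ι → E} (hy : Orthonormal ℝ y)
    {s : Set ι} {z : E} (hz : z ∈ span ℝ (y '' s)) {j : ι} (hj : j ∉ s) : ⟪y j, z⟫ = 0 := by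
  induction hz using span_induction with
  | mem v hv =>
    obtain ⟨i, hi, rfl⟩ := hv
    exact hy.inner_eq_zero fun h => hj (h ▸ hi)
  | zero => simp
  | add u v _ _ hu hv => rw [inner_add_right, hu, hv, add_zero]
  | smul c u _ hu => rw [real_inner_smul_right, hu, mul_zero]

namespace IsPrincipal

variable {k : ℕ} {Y X : Submodule ℝ E} {y x : Fin k → E} {σ : Fin k → ℝ}

theorem left_mem (h : IsPrincipal Y X y x σ) (i : Fin k) : y i ∈ Y :=
  h.span_left ▸ subset_span (Set.mem_range_self i)

theorem finrank_left (h : IsPrincipal Y X y x σ) : finrank ℝ Y = k := by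
  rw [← h.span_left, finrank_span_eq_card h.left_orthonormal.linearIndependent, Fintype.card_fin]

theorem inner_left_right (h : IsPrincipal Y X y x σ) (i j : Fin k) :
    ⟪y i, x j⟫ = if i = j then σ i else 0 := by
  rw [h.inner_eq i _ (h.right_mem j), orthonormal_iff_ite.mp h.right_orthonormal]
  simp

theorem inner_left_right_self (h : IsPrincipal Y X y x σ) (i : Fin k) : ⟪y i, x i⟫ = σ i := by
  rw [h.inner_left_right, if_pos rfl]

theorem le_one (h : IsPrincipal Y X y x σ) (i : Fin k) : σ i ≤ 1 := by
  rw [← h.inner_left_right_self]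
  refine (real_inner_le_norm _ _).trans ?_
  rw [h.left_orthonormal.norm_eq_one, h.right_orthonormal.norm_eq_one, one_mul]

theorem swap (h : IsPrincipal Y X y x σ) (hX : finrank ℝ X = k) [FiniteDimensional ℝ X] :
    IsPrincipal X Y x y σ where
  left_orthonormal := h.right_orthonormal
  right_orthonormal := h.left_orthonormal
  span_left := by
    refine eq_of_le_of_finrank_eq (span_le.mpr ?_) ?_
    · rintro _ ⟨i, rfl⟩
      exact h.right_mem i
    · rw [finrank_span_eq_card h.right_orthonormal.linearIndependent, Fintype.card_fin, hX]
  right_mem := h.left_mem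
  inner_eq i v hv := by
    rw [real_inner_comm, inner_eq_sum_of_mem_span h.left_orthonormal (h.span_left ▸ hv)]
    simp [h.inner_left_right, mul_comm]
  nonneg := h.nonneg
  antitone := h.antitone

theorem inner_right (h : IsPrincipal Y X y x σ) {z v : E} (hz : z ∈ Y) (hv : v ∈ X) :
    ⟪z, v⟫ = ∑ j, ⟪y j, z⟫ * σ j * ⟪x j, v⟫ := by
  rw [inner_eq_sum_of_mem_span h.left_orthonormal (h.span_left ▸ hz)]
  exact Finset.sum_congr rfl fun j _ => by rw [h.inner_eq j v hv, mul_assoc]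

theorem norm_proj_sq (h : IsPrincipal Y X y x σ) [X.HasOrthogonalProjection] {z : E}
    (hz : z ∈ Y) : ‖X.orthogonalProjectionOnto z‖ ^ 2 = ∑ j, σ j ^ 2 * ⟪y j, z⟫ ^ 2 := by
  have h1 : (X.orthogonalProjectionOnto z : E) = ∑ j, (σ j * ⟪y j, z⟫) • x j := by
    refine (eq_starProjection_of_mem_of_inner_eq_zero ?_ ?_)
    · exact sum_mem fun j _ => smul_mem _ _ (h.right_mem j)
    · intro v hv
      rw [inner_sub_left, h.inner_right hz hv, sum_inner]
      simp only [real_inner_smul_left]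
      rw [sub_eq_zero]
      exact Finset.sum_congr rfl fun j _ => by ring
  rw [coe_norm, h1, ← real_inner_self_eq_norm_sq, h.right_orthonormal.inner_sum]
  exact Finset.sum_congr rfl fun j _ => by simp; ring

/-- The last `k - i` principal vectors of `Y` and the first `j + 1` of `L` span subspaces of `L`
whose dimensions add up to `p + 1`, so they share a nonzero `z`. The projection of `z` to `X` has
length at most `σ i * ‖z‖` and at least `μ j * ‖z‖`. -/
theorem interlacing {p : ℕ} {L : Submodule ℝ E} {e m : Fin p → E} {μ : Fin p → ℝ}
    [FiniteDimensional ℝ L] [X.HasOrthogonalProjection]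
    (h : IsPrincipal Y X y x σ) (h' : IsPrincipal L X e m μ) (hYL : Y ≤ L) (i : Fin k)
    (j : Fin p) (hij : (j : ℕ) + k = i + p) : μ j ≤ σ i := by
  classical
  set A := span ℝ (y '' (Finset.Ici i : Finset (Fin k)))
  set B := span ℝ (e '' (Finset.Iic j : Finset (Fin p)))
  have hAY : A ≤ Y := span_le.mpr (by rintro _ ⟨l, -, rfl⟩; exact h.left_mem l)
  have hBL : B ≤ L := span_le.mpr (by rintro _ ⟨l, -, rfl⟩; exact h'.left_mem l)
  have hA : finrank ℝ A = k - i := by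
    rw [finrank_span_orthonormal h.left_orthonormal, Fin.card_Ici]
  have hB : finrank ℝ B = j + 1 := by
    rw [finrank_span_orthonormal h'.left_orthonormal, Fin.card_Iic]
  have : FiniteDimensional ℝ A := finiteDimensional_of_le (hAY.trans hYL)
  have : FiniteDimensional ℝ B := finiteDimensional_of_le hBL
  have hsup : finrank ℝ (A ⊔ B : Submodule ℝ E) ≤ p := by
    rw [← h'.finrank_left]
    exact finrank_mono (sup_le (hAY.trans hYL) hBL)
  have hadd := finrank_sup_add_finrank_inf_eq A B
  have hne : A ⊓ B ≠ ⊥ := by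
    intro h0
    rw [h0, finrank_bot] at hadd
    have := i.2
    have := j.2
    omega
  obtain ⟨z, hz, hz0⟩ := exists_mem_ne_zero_of_ne_bot hne
  have h1 : ‖X.orthogonalProjectionOnto z‖ ^ 2 ≤ σ i ^ 2 * ‖z‖ ^ 2 := by
    rw [h.norm_proj_sq (hAY hz.1), ← sum_inner_sq_of_mem_span h.left_orthonormal
      (h.span_left.symm ▸ hAY hz.1), Finset.mul_sum]
    refine Finset.sum_le_sum fun l _ => ?_
    by_cases hl : i ≤ l
    · gcongr
      · exact h.nonneg l
      · exact h.antitone hl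
    · rw [inner_eq_zero_of_mem_span_image h.left_orthonormal hz.1 (by simpa using hl)]
      simp
  have h2 : μ j ^ 2 * ‖z‖ ^ 2 ≤ ‖X.orthogonalProjectionOnto z‖ ^ 2 := by
    rw [h'.norm_proj_sq (hBL hz.2), ← sum_inner_sq_of_mem_span h'.left_orthonormal
      (h'.span_left.symm ▸ hBL hz.2), Finset.mul_sum]
    refine Finset.sum_le_sum fun l _ => ?_
    by_cases hl : l ≤ j
    · gcongr
      · exact h'.nonneg j
      · exact h'.antitone hl
    · rw [inner_eq_zero_of_mem_span_image h'.left_orthonormal hz.2 (by simpa using hl)]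
      simp
  have hz1 : 0 < ‖z‖ ^ 2 := by positivity
  exact le_of_sq_le_sq (le_of_mul_le_mul_right (h2.trans h1) hz1) (h.nonneg i)

theorem unique [FiniteDimensional ℝ Y] [X.HasOrthogonalProjection] {y' x' : Fin k → E}
    {σ' : Fin k → ℝ} (h : IsPrincipal Y X y x σ) (h' : IsPrincipal Y X y' x' σ') : σ = σ' :=
  funext fun i => le_antisymm (h'.interlacing h le_rfl i i rfl) (h.interlacing h' le_rfl i i rfl)

end IsPrincipal

end Principal

/-! ### Jordan angles expressed by principal vectors -/

variable {p q : ℕ}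

theorem cosAngle_eq_singularValues (L M : Gr p q) (j : Fin p) :
    cosAngle L M j = (projMap M.1 L.1).singularValues j := by
  refine singularValues_comp_isometries _ _ (onb M).repr (onb L).repr (fun v => ?_) j
  ext i
  rw [(onb L).repr_apply_apply, real_inner_comm, inner_projMap, real_inner_comm]
  simp only [Matrix.toLpLin_apply, Matrix.mulVec, dotProduct, crossGram, Matrix.of_apply,
    (onb M).repr_apply_apply]
  have h : (v : Euc p q) = ∑ k, ⟪onb M k, v⟫ • (onb M k : Euc p q) := by
    conv_lhs => rw [← (onb M).sum_repr' v]
    simp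
  conv_rhs => rw [h, inner_sum]
  refine Finset.sum_congr rfl fun k _ => ?_
  rw [real_inner_smul_right, mul_comm]

theorem exists_isPrincipal_cosAngle (L M : Gr p q) :
    ∃ e m : Fin p → Euc p q, IsPrincipal L.1 M.1 e m (cosAngle L M) := by
  obtain ⟨m, e, h⟩ := exists_isPrincipal M.1 L.1 M.2 L.2.ge
  refine ⟨e, m, ?_⟩
  have : cosAngle L M = fun i : Fin p => (projMap M.1 L.1).singularValues i :=
    funext fun i => cosAngle_eq_singularValues L M i
  rw [this]
  exact h.swap L.2

theorem cosAngle_eq {L M : Gr p q} {e m : Fin p → Euc p q} {σ : Fin p → ℝ}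
    (h : IsPrincipal L.1 M.1 e m σ) : cosAngle L M = σ := by
  obtain ⟨e', m', h'⟩ := exists_isPrincipal_cosAngle L M
  exact h'.unique h

end JordanAngles

/-! ### Convexity, majorization and one-sided derivative estimates -/

namespace JordanAngles

open Module Submodule Filter Topology
open scoped RealInnerProductSpace

/-- Jensen's inequality for the concave sine on `[0, π]`, the missing weight `1 - ∑ w j` being
placed at the angle `0`. -/
theorem arcsin_sum_le {ι : Type*} [Fintype ι] (w u : ι → ℝ) (hw : ∀ j, 0 ≤ w j)
    (hw1 : ∑ j, w j ≤ 1) (hu : ∀ j, 0 ≤ u j) (hu1 : ∀ j, u j ≤ 1) :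
    Real.arcsin (∑ j, w j * u j) ≤ ∑ j, w j * Real.arcsin (u j) := by
  have hθ : ∀ j, 0 ≤ Real.arcsin (u j) := fun j => Real.arcsin_nonneg.mpr (hu j)
  have hθ1 : ∀ j, Real.arcsin (u j) ≤ Real.pi / 2 := fun j => Real.arcsin_le_pi_div_two _
  have h := strictConcaveOn_sin_Icc.concaveOn.le_map_sum (t := Finset.univ)
    (w := fun o : Option ι => o.elim (1 - ∑ j, w j) w)
    (p := fun o : Option ι => o.elim 0 fun j => Real.arcsin (u j))
    (by rintro (_ | j) -
        · simpa using hw1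
        · exact hw j)
    (by simp [Fintype.sum_option])
    (by rintro (_ | j) -
        · exact ⟨le_rfl, Real.pi_pos.le⟩
        · exact ⟨hθ j, (hθ1 j).trans (by linarith [Real.pi_pos])⟩)
  have hsin : ∀ j, Real.sin (Real.arcsin (u j)) = u j := fun j =>
    Real.sin_arcsin (by linarith [hu j]) (hu1 j)
  simp only [Fintype.sum_option, Option.elim, smul_eq_mul, mul_zero, zero_add, Real.sin_zero,
    hsin] at h
  have h0 : 0 ≤ ∑ j, w j * Real.arcsin (u j) :=
    Finset.sum_nonneg fun j _ => mul_nonneg (hw j) (hθ j)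
  have h1 : ∑ j, w j * Real.arcsin (u j) ≤ Real.pi / 2 := by
    calc _ ≤ ∑ j, w j * (Real.pi / 2) :=
          Finset.sum_le_sum fun j _ => mul_le_mul_of_nonneg_left (hθ1 j) (hw j)
      _ = (∑ j, w j) * (Real.pi / 2) := by rw [Finset.sum_mul]
      _ ≤ _ := by nlinarith [Real.pi_pos]
  calc _ ≤ Real.arcsin (Real.sin (∑ j, w j * Real.arcsin (u j))) := Real.monotone_arcsin h
    _ = _ := Real.arcsin_sin (by linarith [Real.pi_pos]) h1

theorem sum_arcsin_le {ι κ : Type*} [Fintype ι] [Fintype κ] (S : ι → κ → ℝ) (d : ι → ℝ)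
    (u : κ → ℝ) (hS : ∀ i j, 0 ≤ S i j) (hrow : ∀ i, ∑ j, S i j ≤ 1) (hcol : ∀ j, ∑ i, S i j ≤ 1)
    (hu : ∀ j, 0 ≤ u j) (hu1 : ∀ j, u j ≤ 1) (hd : ∀ i, d i ≤ ∑ j, S i j * u j) :
    ∑ i, Real.arcsin (d i) ≤ ∑ j, Real.arcsin (u j) := by
  calc _ ≤ ∑ i, ∑ j, S i j * Real.arcsin (u j) := Finset.sum_le_sum fun i _ =>
        (Real.monotone_arcsin (hd i)).trans (arcsin_sum_le _ _ (hS i) (hrow i) hu hu1)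
    _ = ∑ j, (∑ i, S i j) * Real.arcsin (u j) := by
        rw [Finset.sum_comm]
        simp only [Finset.sum_mul]
    _ ≤ _ := Finset.sum_le_sum fun j _ =>
        mul_le_of_le_one_left (Real.arcsin_nonneg.mpr (hu j)) (hcol j)

section Frames

variable {E : Type*} [NormedAddCommGroup E] [InnerProductSpace ℝ E]

/-- Bessel's inequality for orthogonal vectors that may be shorter than unit length, as the damped
directions in the first variation are. -/
theorem sum_inner_sq_le_of_pairwise_orthogonal {ι : Type*} [Fintype ι] {z : ι → E}
    (hz : ∀ i, ‖z i‖ ≤ 1) (ho : Pairwise fun i j => ⟪z i, z j⟫ = 0) (v : E) :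
    ∑ i, ⟪z i, v⟫ ^ 2 ≤ ‖v‖ ^ 2 := by
  classical
  have h1 : ⟪v, ∑ i, ⟪z i, v⟫ • z i⟫ = ∑ i, ⟪z i, v⟫ ^ 2 := by
    rw [inner_sum]
    exact Finset.sum_congr rfl fun i _ => by
      rw [real_inner_smul_right, real_inner_comm v, sq]
  have h2 : ‖∑ i, ⟪z i, v⟫ • z i‖ ^ 2 ≤ ∑ i, ⟪z i, v⟫ ^ 2 := by
    rw [← real_inner_self_eq_norm_sq, sum_inner]
    refine Finset.sum_le_sum fun i _ => ?_
    rw [inner_sum, Finset.sum_eq_single i]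
    · rw [real_inner_smul_left, real_inner_smul_right, real_inner_self_eq_norm_sq]
      have : ‖z i‖ ^ 2 ≤ 1 := pow_le_one₀ (norm_nonneg _) (hz i)
      nlinarith [sq_nonneg ⟪z i, v⟫]
    · intro j _ hj
      rw [real_inner_smul_left, real_inner_smul_right, ho hj.symm, mul_zero, mul_zero]
    · simp
  have h3 := norm_sub_sq_real v (∑ i, ⟪z i, v⟫ • z i)
  nlinarith [sq_nonneg ‖v - ∑ i, ⟪z i, v⟫ • z i‖]

variable {k : ℕ} {Y X : Submodule ℝ E} {y x : Fin k → E} {σ : Fin k → ℝ}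

/-- Principal vectors minimize the sum of the angles between corresponding vectors of two
orthonormal frames, also after all cosines are multiplied by `c`. -/
theorem IsPrincipal.sum_arccos_le (h : IsPrincipal Y X y x σ) {y' x' : Fin k → E}
    (hy : Orthonormal ℝ y') (hx : Orthonormal ℝ x') (hyY : ∀ i, y' i ∈ Y) (hxX : ∀ i, x' i ∈ X)
    {c : ℝ} (hc : 0 ≤ c) (hc1 : c ≤ 1) :
    ∑ i, Real.arccos (c * σ i) ≤ ∑ i, Real.arccos (c * ⟪y' i, x' i⟫) := by
  -- The scalar product of `y' i` and `x' i` is `∑ j, ⟪y j, y' i⟫ * σ j * ⟪x j, x' i⟫`. Replacing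
  -- the product of coefficients by the mean of their squares gives a matrix that is doubly
  -- substochastic by Bessel.
  have key := sum_arcsin_le (fun i j => (⟪y j, y' i⟫ ^ 2 + ⟪x j, x' i⟫ ^ 2) / 2)
    (fun i => c * ⟪y' i, x' i⟫) (fun j => c * σ j) (fun i j => by positivity)
    (fun i => by
      have h1 := sum_inner_sq_le h.left_orthonormal (y' i)
      have h2 := sum_inner_sq_le h.right_orthonormal (x' i)
      rw [hy.norm_eq_one] at h1
      rw [hx.norm_eq_one] at h2
      rw [← Finset.sum_div, Finset.sum_add_distrib]
      linarith)
    (fun j => by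
      have h1 := sum_inner_sq_le hy (y j)
      have h2 := sum_inner_sq_le hx (x j)
      rw [h.left_orthonormal.norm_eq_one] at h1
      rw [h.right_orthonormal.norm_eq_one] at h2
      simp only [real_inner_comm (y _), real_inner_comm (x _)] at h1 h2 ⊢
      rw [← Finset.sum_div, Finset.sum_add_distrib]
      linarith)
    (fun j => mul_nonneg hc (h.nonneg j)) (fun j => mul_le_one₀ hc1 (h.nonneg j) (h.le_one j))
    (fun i => by
      rw [h.inner_right (hyY i) (hxX i), Finset.mul_sum]
      refine Finset.sum_le_sum fun j _ => ?_
      have := mul_nonneg hc (h.nonneg j)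
      nlinarith [mul_nonneg this (sq_nonneg (⟪y j, y' i⟫ - ⟪x j, x' i⟫))])
  simp only [Real.arccos, Finset.sum_sub_distrib]
  linarith

end Frames

/-- To the right of `t` the slopes of `f` are bounded by those of `g`, so the upper right derivative
of `f` is at most `S` although `f` itself need not be differentiable. -/
theorem le_add_of_touching_above {f : ℝ → ℝ} (hf : Continuous f) {S : ℝ}
    (h : ∀ t, ∃ (g : ℝ → ℝ) (g' : ℝ), HasDerivAt g g' t ∧ g t = f t ∧ (∀ s, f s ≤ g s) ∧ g' ≤ S) :
    f 1 ≤ f 0 + S := by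
  have key := image_le_of_liminf_slope_right_le_deriv_boundary (f := f) (a := 0) (b := 1)
    hf.continuousOn (B := fun t => f 0 + S * t) (B' := fun _ => S) (by simp) (by fun_prop)
    (fun t _ => by
      simpa using (((hasDerivAt_id t).const_mul S).const_add (f 0)).hasDerivWithinAt)
    (fun t _ r hr => by
      obtain ⟨g, g', hg, hgt, hfg, hS⟩ := h t
      have h1 : ∀ᶠ z in 𝓝[>] t, slope g t z < r :=
        ((hasDerivAt_iff_tendsto_slope.mp hg).mono_left
          (nhdsWithin_mono t fun z hz => ne_of_gt hz)).eventually_lt_const (hS.trans_lt hr)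
      refine Eventually.frequently ?_
      filter_upwards [h1, self_mem_nhdsWithin] with z hz hz'
      refine lt_of_le_of_lt ?_ hz
      rw [slope_def_field, slope_def_field, hgt]
      have : 0 < z - t := sub_pos.mpr hz'
      gcongr
      exact hfg z)
  simpa using key (Set.right_mem_Icc.mpr zero_le_one)

theorem sum_mul_le_sum_natAdd {m k : ℕ} {a s : Fin (m + k) → ℝ} (ha : ∀ j, 0 ≤ a j)
    (hmono : Monotone a) (hs : ∀ j, 0 ≤ s j) (hs1 : ∀ j, s j ≤ 1) (hsum : ∑ j, s j ≤ k) :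
    ∑ j, s j * a j ≤ ∑ i : Fin k, a (Fin.natAdd m i) := by
  rcases k with _ | k
  · have : ∀ j, s j = 0 := by
      have h0 : ∑ j, s j = 0 := le_antisymm (by simpa using hsum) (Finset.sum_nonneg fun j _ => hs j)
      exact fun j => (Finset.sum_eq_zero_iff_of_nonneg fun j _ => hs j).mp h0 j (Finset.mem_univ j)
    simp [this]
  -- The smallest of the `k + 1` largest coefficients serves as threshold: below it `a j ≤ τ`, above
  -- it the full weight `1` is optimal, and the total weight pays for `τ`.
  · set τ := a (Fin.natAdd m 0)
    rw [Fin.sum_univ_add] at hsum ⊢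
    have h1 : ∀ i : Fin m, s (Fin.castAdd (k + 1) i) * a (Fin.castAdd (k + 1) i) ≤
        s (Fin.castAdd (k + 1) i) * τ := fun i =>
      mul_le_mul_of_nonneg_left (hmono (by rw [Fin.le_def]; simp)) (hs _)
    have h2 : ∀ i : Fin (k + 1), s (Fin.natAdd m i) * a (Fin.natAdd m i) ≤
        a (Fin.natAdd m i) - τ + s (Fin.natAdd m i) * τ := fun i => by
      have : τ ≤ a (Fin.natAdd m i) := hmono (by rw [Fin.le_def]; simp)
      nlinarith [hs1 (Fin.natAdd m i)]
    have h1' := Finset.sum_le_sum fun i (_ : i ∈ Finset.univ) => h1 i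
    have h2' := Finset.sum_le_sum fun i (_ : i ∈ Finset.univ) => h2 i
    rw [← Finset.sum_mul] at h1'
    rw [Finset.sum_add_distrib, Finset.sum_sub_distrib, ← Finset.sum_mul] at h2'
    simp only [Finset.sum_const, Finset.card_univ, Fintype.card_fin, nsmul_eq_mul] at h2'
    have h3 := mul_le_mul_of_nonneg_right hsum (ha (Fin.natAdd m 0))
    change _ * τ ≤ _ * τ at h3
    rw [add_mul] at h3
    linarith

/-- Abel summation: subtracting the constant `w 0` from all weights splits off the full sum, and the
remaining weights start with `0` and are again increasing. -/
theorem sum_mul_nonneg_of_sum_ge_nonneg {p : ℕ} (w D : Fin p → ℝ) (hw : ∀ j, 0 ≤ w j)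
    (hmono : Monotone w) (hD : ∀ n : ℕ, 0 ≤ ∑ i : Fin p, if n ≤ (i : ℕ) then D i else 0) :
    0 ≤ ∑ i, w i * D i := by
  induction p with
  | zero => simp
  | succ p ih =>
    have h0 := hD 0
    simp only [zero_le, if_true] at h0
    have h1 := ih (fun i => w i.succ - w 0) (fun i => D i.succ)
      (fun i => sub_nonneg.mpr (hmono (Fin.zero_le _)))
      (fun i j hij => sub_le_sub_right (hmono (Fin.succ_le_succ_iff.mpr hij)) _)
      (fun n => by simpa [Fin.sum_univ_succ] using hD (n + 1))
    have h2 := mul_nonneg (hw 0) h0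
    rw [Fin.sum_univ_succ] at h2 ⊢
    simp only [sub_mul, Finset.sum_sub_distrib, ← Finset.mul_sum] at h1
    linarith

end JordanAngles

/-! ### Rotating frames and the first variation of the angle sum -/

namespace JordanAngles

open Module Submodule Filter Topology
open scoped RealInnerProductSpace

variable {E : Type*} [NormedAddCommGroup E] [InnerProductSpace ℝ E]

/-- The frame `v` rotated towards the frame `w` with angular velocities `a`. -/
def rotFrame {ι : Type*} (v w : ι → E) (a : ι → ℝ) (t : ℝ) (j : ι) : E :=
  Real.cos (a j * t) • v j + Real.sin (a j * t) • w j

section RotFrame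

variable {ι : Type*} {v w : ι → E} (a : ι → ℝ)

theorem inner_rotFrame (hv : Orthonormal ℝ v) (hw : Orthonormal ℝ w)
    (hvw : ∀ i j, ⟪v i, w j⟫ = 0) [DecidableEq ι] (s t : ℝ) (i j : ι) :
    ⟪rotFrame v w a s i, rotFrame v w a t j⟫ =
      if i = j then Real.cos (a i * (s - t)) else 0 := by
  have hwv : ⟪w i, v j⟫ = 0 := by rw [real_inner_comm, hvw]
  simp only [rotFrame, inner_add_left, inner_add_right, real_inner_smul_left,
    real_inner_smul_right, orthonormal_iff_ite.mp hv, orthonormal_iff_ite.mp hw, hvw, hwv]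
  split_ifs with h
  · subst h
    rw [mul_sub, Real.cos_sub]
    ring
  · ring

theorem orthonormal_rotFrame (hv : Orthonormal ℝ v) (hw : Orthonormal ℝ w)
    (hvw : ∀ i j, ⟪v i, w j⟫ = 0) (t : ℝ) : Orthonormal ℝ (rotFrame v w a t) := by
  classical
  rw [orthonormal_iff_ite]
  intro i j
  rw [inner_rotFrame a hv hw hvw]
  simp

theorem inner_rotFrame_neg (hv : Orthonormal ℝ v) (hw : Orthonormal ℝ w)
    (hvw : ∀ i j, ⟪v i, w j⟫ = 0) (t : ℝ) (i j : ι) :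
    ⟪rotFrame v w a t i, rotFrame w (-v) a t j⟫ = 0 := by
  classical
  have hwv : ⟪w i, v j⟫ = 0 := by rw [real_inner_comm, hvw]
  simp only [rotFrame, inner_add_left, inner_add_right, real_inner_smul_left,
    real_inner_smul_right, Pi.neg_apply, inner_neg_right, orthonormal_iff_ite.mp hv,
    orthonormal_iff_ite.mp hw, hvw, hwv]
  split_ifs with h
  · subst h
    ring
  · ring

theorem hasDerivAt_rotFrame (t : ℝ) (j : ι) :
    HasDerivAt (fun t => rotFrame v w a t j) (a j • rotFrame w (-v) a t j) t := by
  have h : HasDerivAt (fun t => a j * t) (a j) t := by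
    simpa using (hasDerivAt_id t).const_mul (a j)
  refine ((h.cos.smul_const (v j)).add (h.sin.smul_const (w j))).congr_deriv ?_
  simp only [rotFrame, Pi.neg_apply]
  module

theorem continuous_rotFrame (j : ι) : Continuous fun t => rotFrame v w a t j := by
  unfold rotFrame
  fun_prop

end RotFrame

/-- The sum of the angles between `Y` and `X`, after all cosines are multiplied by `c`. -/
def dampedAngleSum (k : ℕ) (c : ℝ) (Y X : Submodule ℝ E) [FiniteDimensional ℝ Y]
    [FiniteDimensional ℝ X] : ℝ :=
  ∑ i : Fin k, Real.arccos (c * (projMap Y X).singularValues i)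

theorem IsPrincipal.dampedAngleSum_eq {k : ℕ} {Y X : Submodule ℝ E} [FiniteDimensional ℝ Y]
    [FiniteDimensional ℝ X] {y x : Fin k → E} {σ : Fin k → ℝ} (h : IsPrincipal Y X y x σ)
    (hX : k ≤ finrank ℝ X) (c : ℝ) :
    dampedAngleSum k c Y X = ∑ i, Real.arccos (c * σ i) := by
  obtain ⟨y', x', h'⟩ := exists_isPrincipal Y X h.finrank_left hX
  have := h'.unique h
  exact Finset.sum_congr rfl fun i _ => by rw [← this]

section Moving

variable {k p : ℕ} {v w : Fin p → E} (a : Fin p → ℝ)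

/-- The span of a rotating frame. -/
abbrev rotSpan (v w : Fin p → E) (a : Fin p → ℝ) (t : ℝ) : Submodule ℝ E :=
  span ℝ (Set.range (rotFrame v w a t))

instance finiteDimensional_rotSpan (t : ℝ) : FiniteDimensional ℝ (rotSpan v w a t) :=
  FiniteDimensional.span_of_finite ℝ (Set.finite_range _)

/-- A frame in `rotSpan v w a t`, carried along to `rotSpan v w a s`. -/
def transport (v w : Fin p → E) (a : Fin p → ℝ) (t s : ℝ) (x : E) : E :=
  ∑ j, ⟪rotFrame v w a t j, x⟫ • rotFrame v w a s j

theorem finrank_rotSpan (hv : Orthonormal ℝ v) (hw : Orthonormal ℝ w)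
    (hvw : ∀ i j, ⟪v i, w j⟫ = 0) (t : ℝ) : finrank ℝ (rotSpan v w a t) = p := by
  rw [finrank_span_eq_card (orthonormal_rotFrame a hv hw hvw t).linearIndependent,
    Fintype.card_fin]

theorem transport_mem (t s : ℝ) (x : E) : transport v w a t s x ∈ rotSpan v w a s :=
  sum_mem fun j _ => smul_mem _ _ (subset_span (Set.mem_range_self j))

theorem transport_self (hv : Orthonormal ℝ v) (hw : Orthonormal ℝ w)
    (hvw : ∀ i j, ⟪v i, w j⟫ = 0) {t : ℝ} {x : E} (hx : x ∈ rotSpan v w a t) :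
    transport v w a t t x = x :=
  (eq_sum_inner_of_mem_span (orthonormal_rotFrame a hv hw hvw t) hx).symm

theorem orthonormal_transport (hv : Orthonormal ℝ v) (hw : Orthonormal ℝ w)
    (hvw : ∀ i j, ⟪v i, w j⟫ = 0) {t : ℝ} {x : Fin k → E} (hx : Orthonormal ℝ x)
    (hxt : ∀ i, x i ∈ rotSpan v w a t) (s : ℝ) :
    Orthonormal ℝ fun i => transport v w a t s (x i) := by
  rw [orthonormal_iff_ite] at hx ⊢
  intro i l
  rw [← hx i l, inner_eq_sum_of_mem_span (orthonormal_rotFrame a hv hw hvw t) (hxt i) (x l)]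
  unfold transport
  rw [(orthonormal_rotFrame a hv hw hvw s).inner_sum]
  simp

theorem norm_transport_sub_le (hv : Orthonormal ℝ v) (hw : Orthonormal ℝ w)
    (hvw : ∀ i j, ⟪v i, w j⟫ = 0) {t : ℝ} {x : E} (hx : x ∈ rotSpan v w a t) (hx1 : ‖x‖ = 1)
    (s : ℝ) :
    ‖transport v w a t s x - x‖ ≤ ∑ j, ‖rotFrame v w a s j - rotFrame v w a t j‖ := by
  have hsub : transport v w a t s x - x = ∑ j, (⟪rotFrame v w a t j, x⟫ • rotFrame v w a s j -
      ⟪rotFrame v w a t j, x⟫ • rotFrame v w a t j) := by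
    rw [Finset.sum_sub_distrib]
    exact congrArg _ (transport_self a hv hw hvw hx).symm
  rw [hsub]
  refine (norm_sum_le _ _).trans (Finset.sum_le_sum fun j _ => ?_)
  rw [← smul_sub, norm_smul]
  refine mul_le_of_le_one_left (norm_nonneg _) ((norm_inner_le_norm _ _).trans ?_)
  rw [(orthonormal_rotFrame a hv hw hvw t).norm_eq_one, hx1, one_mul]

/-- The transported principal frame is an admissible competitor at time `s`; equality at `s = t`
makes the right-hand side the upper touching function. -/
theorem dampedAngleSum_rotSpan_le (hv : Orthonormal ℝ v) (hw : Orthonormal ℝ w)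
    (hvw : ∀ i j, ⟪v i, w j⟫ = 0) (hk : k ≤ p) {Y : Submodule ℝ E} [FiniteDimensional ℝ Y]
    {t : ℝ} {y x : Fin k → E} {σ : Fin k → ℝ} (h : IsPrincipal Y (rotSpan v w a t) y x σ)
    {c : ℝ} (hc : 0 ≤ c) (hc1 : c ≤ 1) (s : ℝ) :
    dampedAngleSum k c Y (rotSpan v w a s) ≤
      ∑ i, Real.arccos (c * ⟪y i, transport v w a t s (x i)⟫) := by
  have hs := (finrank_rotSpan a hv hw hvw s).ge
  obtain ⟨y', x', h'⟩ := exists_isPrincipal Y (rotSpan v w a s) h.finrank_left (hk.trans hs)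
  exact h'.sum_arccos_le h.left_orthonormal
    (orthonormal_transport a hv hw hvw h.right_orthonormal h.right_mem s) h.left_mem
    (fun i => transport_mem a t s _) hc hc1

theorem uniformContinuousOn_arccos : UniformContinuousOn Real.arccos (Set.Icc (-1) 1) :=
  isCompact_Icc.uniformContinuousOn_of_continuous Real.continuous_arccos.continuousOn

theorem continuous_dampedAngleSum (hv : Orthonormal ℝ v) (hw : Orthonormal ℝ w)
    (hvw : ∀ i j, ⟪v i, w j⟫ = 0) (hk : k ≤ p) {Y : Submodule ℝ E} [FiniteDimensional ℝ Y]
    (hY : finrank ℝ Y = k) {c : ℝ} (hc : 0 ≤ c) (hc1 : c ≤ 1) :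
    Continuous fun t => dampedAngleSum k c Y (rotSpan v w a t) := by
  set D : ℝ → ℝ → ℝ := fun s t => ∑ j, ‖rotFrame v w a s j - rotFrame v w a t j‖
  -- Since `δ` depends on neither `s` nor `t`, exchanging the two turns this one-sided estimate into
  -- continuity.
  have hbound : ∀ ε > 0, ∃ δ > 0, ∀ s t, D s t < δ →
      dampedAngleSum k c Y (rotSpan v w a s) ≤ dampedAngleSum k c Y (rotSpan v w a t) + k * ε := by
    intro ε hε
    obtain ⟨δ, hδ, H⟩ := Metric.uniformContinuousOn_iff.mp uniformContinuousOn_arccos ε hε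
    refine ⟨δ, hδ, fun s t hst => ?_⟩
    have ht := (finrank_rotSpan a hv hw hvw t).ge
    obtain ⟨y, x, h⟩ := exists_isPrincipal Y (rotSpan v w a t) hY (hk.trans ht)
    refine (dampedAngleSum_rotSpan_le a hv hw hvw hk h hc hc1 s).trans ?_
    rw [h.dampedAngleSum_eq (hk.trans ht)]
    have hmem : ∀ z : E, ∀ i, ‖z‖ = 1 → c * ⟪y i, z⟫ ∈ Set.Icc (-1 : ℝ) 1 := by
      intro z i hz
      have h1 := abs_real_inner_le_norm (y i) z
      rw [h.left_orthonormal.norm_eq_one, hz, one_mul] at h1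
      rw [Set.mem_Icc, ← abs_le, abs_mul, abs_of_nonneg hc]
      exact mul_le_one₀ hc1 (abs_nonneg _) h1
    have hkε : (k : ℝ) * ε = ∑ _i : Fin k, ε := by simp
    rw [hkε, ← Finset.sum_add_distrib]
    refine Finset.sum_le_sum fun i _ => ?_
    have hor := orthonormal_transport a hv hw hvw h.right_orthonormal h.right_mem s
    have h2 := H _ (hmem _ i (hor.norm_eq_one i)) _
      (hmem _ i (h.right_orthonormal.norm_eq_one i)) (by
        rw [Real.dist_eq, ← mul_sub, ← inner_sub_right, abs_mul, abs_of_nonneg hc]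
        refine lt_of_le_of_lt ?_ hst
        refine (mul_le_of_le_one_left (abs_nonneg _) hc1).trans ?_
        refine (abs_real_inner_le_norm _ _).trans ?_
        rw [h.left_orthonormal.norm_eq_one, one_mul]
        exact norm_transport_sub_le a hv hw hvw (h.right_mem i)
          (h.right_orthonormal.norm_eq_one i) s)
    rw [Real.dist_eq, h.inner_left_right_self] at h2
    linarith [(abs_lt.mp h2).2]
  rw [continuous_iff_continuousAt]
  intro t
  rw [Metric.continuousAt_iff']
  intro ε hε
  obtain ⟨δ, hδ, H⟩ := hbound (ε / (k + 1)) (by positivity)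
  have hk1 : (k : ℝ) * (ε / (k + 1)) < ε := by
    rw [mul_div_assoc', div_lt_iff₀ (by positivity)]
    nlinarith
  have hD : ∀ᶠ s in 𝓝 t, D s t < δ := by
    have hcont : Continuous fun s => D s t :=
      continuous_finsetSum _ fun j _ => ((continuous_rotFrame a j).sub continuous_const).norm
    have h0 : D t t = 0 := by simp [D]
    exact hcont.continuousAt.eventually_lt_const (by simpa [h0] using hδ)
  filter_upwards [hD] with s hs
  have hs' : D t s < δ := by simpa only [D, norm_sub_rev] using hs
  rw [Real.dist_eq, abs_lt]
  constructor <;> linarith [H s t hs, H t s hs']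

end Moving

/-- The velocities of the frame are orthogonal to the moving subspace, so subtracting `σ i • x i`
from `y i` changes nothing. It is done because the vectors `y i - σ i • x i` are pairwise
orthogonal. The bound `c < 1` keeps the argument of `arccos` away from `1`. -/
theorem hasDerivAt_sum_arccos_transport {k p : ℕ} {v w : Fin p → E} (a : Fin p → ℝ)
    (hv : Orthonormal ℝ v) (hw : Orthonormal ℝ w) (hvw : ∀ i j, ⟪v i, w j⟫ = 0)
    {Y : Submodule ℝ E} {t : ℝ} {y x : Fin k → E} {σ : Fin k → ℝ}
    (h : IsPrincipal Y (rotSpan v w a t) y x σ) {c : ℝ} (hc : 0 ≤ c) (hc1 : c < 1) :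
    HasDerivAt (fun s => ∑ i, Real.arccos (c * ⟪y i, transport v w a t s (x i)⟫))
      (∑ i, ∑ j, ⟪rotFrame v w a t j, x i⟫ *
        ⟪(-(c / √(1 - (c * σ i) ^ 2))) • (y i - σ i • x i), rotFrame w (-v) a t j⟫ * a j) t := by
  have hu := orthonormal_rotFrame a hv hw hvw t
  refine HasDerivAt.fun_sum fun i _ => ?_
  have hσ : c * σ i < 1 := lt_of_le_of_lt (mul_le_of_le_one_right hc (h.le_one i)) hc1
  have hσ0 : 0 ≤ c * σ i := mul_nonneg hc (h.nonneg i)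
  have hd : HasDerivAt (fun s => transport v w a t s (x i))
      (∑ j, ⟪rotFrame v w a t j, x i⟫ • a j • rotFrame w (-v) a t j) t :=
    HasDerivAt.fun_sum fun j _ => (hasDerivAt_rotFrame a t j).const_smul _
  have hval : c * ⟪y i, transport v w a t t (x i)⟫ = c * σ i := by
    rw [transport_self a hv hw hvw (h.right_mem i), h.inner_left_right_self]
  have hin : HasDerivAt (fun s => c * ⟪y i, transport v w a t s (x i)⟫)
      (c * ⟪y i, ∑ j, ⟪rotFrame v w a t j, x i⟫ • a j • rotFrame w (-v) a t j⟫) t := by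
    simpa using ((hasDerivAt_const t (y i)).inner ℝ hd).const_mul c
  have harc := Real.hasDerivAt_arccos (x := c * ⟪y i, transport v w a t t (x i)⟫)
    (by rw [hval]; linarith) (by rw [hval]; exact hσ.ne)
  have hcomp := harc.comp t hin
  rw [hval] at hcomp
  refine hcomp.congr_deriv ?_
  have hx0 : ∀ j, ⟪x i, rotFrame w (-v) a t j⟫ = 0 := by
    intro j
    rw [inner_eq_sum_of_mem_span hu (h.right_mem i)]
    simp [inner_rotFrame_neg a hv hw hvw]
  simp only [inner_sum, real_inner_smul_right, real_inner_smul_left, inner_sub_left, hx0,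
    Finset.mul_sum]
  exact Finset.sum_congr rfl fun j _ => by ring

/-- The first variation of the sum of the angles is at most the sum of the largest velocities. -/
theorem first_variation_le {m k : ℕ} {v w : Fin (m + k) → E} {a : Fin (m + k) → ℝ}
    (ha : ∀ j, 0 ≤ a j) (hmono : Monotone a)
    (hv : Orthonormal ℝ v) (hw : Orthonormal ℝ w) (hvw : ∀ i j, ⟪v i, w j⟫ = 0)
    {Y : Submodule ℝ E} {t : ℝ} {y x : Fin k → E} {σ : Fin k → ℝ}
    (h : IsPrincipal Y (rotSpan v w a t) y x σ) {c : ℝ} (hc : 0 ≤ c) (hc1 : c < 1) :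
    ∑ i, ∑ j, ⟪rotFrame v w a t j, x i⟫ *
        ⟪(-(c / √(1 - (c * σ i) ^ 2))) • (y i - σ i • x i), rotFrame w (-v) a t j⟫ * a j ≤
      ∑ i : Fin k, a (Fin.natAdd m i) := by
  have hu := orthonormal_rotFrame a hv hw hvw t
  have hu' : Orthonormal ℝ (rotFrame w (-v) a t) := by
    refine orthonormal_rotFrame a hw ?_ ?_ t
    · rw [orthonormal_iff_ite] at hv ⊢
      simpa using hv
    · intro i j
      rw [Pi.neg_apply, inner_neg_right, real_inner_comm, hvw, neg_zero]
  set z : Fin k → E := fun i => (-(c / √(1 - (c * σ i) ^ 2))) • (y i - σ i • x i)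
  have hyy := orthonormal_iff_ite.mp h.left_orthonormal
  have hxx := orthonormal_iff_ite.mp h.right_orthonormal
  have hin : ∀ i j, ⟪y i - σ i • x i, y j - σ j • x j⟫ = if i = j then 1 - σ i ^ 2 else 0 := by
    intro i j
    have hxy : ⟪x i, y j⟫ = if j = i then σ j else 0 := by
      rw [real_inner_comm, h.inner_left_right]
    simp only [inner_sub_left, inner_sub_right, real_inner_smul_left, real_inner_smul_right,
      hyy, hxx, hxy, h.inner_left_right]
    by_cases hij : i = j
    · subst hij
      simp only [if_true]
      ring
    · simp [hij, Ne.symm hij]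
  -- The squared length is `c² (1 - σ²) / (1 - c² σ²)`, at most `1` because `c ≤ 1`.
  have hz1 : ∀ i, ‖z i‖ ≤ 1 := by
    intro i
    have hσ := h.le_one i
    have hσ0 := h.nonneg i
    have hcσ : c * σ i < 1 := lt_of_le_of_lt (mul_le_of_le_one_right hc hσ) hc1
    have hpos : 0 < 1 - (c * σ i) ^ 2 := by
      have := mul_nonneg hc hσ0
      nlinarith
    refine (sq_le_one_iff₀ (norm_nonneg _)).mp ?_
    rw [← real_inner_self_eq_norm_sq]
    simp only [z, real_inner_smul_left, real_inner_smul_right, hin, if_true]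
    have hsq := Real.sq_sqrt hpos.le
    have : -(c / √(1 - (c * σ i) ^ 2)) * (-(c / √(1 - (c * σ i) ^ 2)) * (1 - σ i ^ 2)) =
        c ^ 2 * (1 - σ i ^ 2) / (1 - (c * σ i) ^ 2) := by
      rw [← hsq]
      simp only [Real.sqrt_sq (Real.sqrt_nonneg _)]
      field_simp
    rw [this, div_le_one hpos]
    nlinarith
  have hzo : Pairwise fun i j => ⟪z i, z j⟫ = 0 := by
    intro i j hij
    simp only [z, real_inner_smul_left, real_inner_smul_right, hin, if_neg hij, mul_zero]
  have hle : ∀ i j, ⟪rotFrame v w a t j, x i⟫ * ⟪z i, rotFrame w (-v) a t j⟫ * a j ≤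
      (⟪rotFrame v w a t j, x i⟫ ^ 2 + ⟪z i, rotFrame w (-v) a t j⟫ ^ 2) / 2 * a j := by
    intro i j
    refine mul_le_mul_of_nonneg_right ?_ (ha j)
    nlinarith [sq_nonneg (⟪rotFrame v w a t j, x i⟫ - ⟪z i, rotFrame w (-v) a t j⟫)]
  calc _ ≤ ∑ i, ∑ j,
        (⟪rotFrame v w a t j, x i⟫ ^ 2 + ⟪z i, rotFrame w (-v) a t j⟫ ^ 2) / 2 * a j :=
        Finset.sum_le_sum fun i _ => Finset.sum_le_sum fun j _ => hle i j
    _ = ∑ j, (∑ i, (⟪rotFrame v w a t j, x i⟫ ^ 2 +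
          ⟪z i, rotFrame w (-v) a t j⟫ ^ 2) / 2) * a j := by
        rw [Finset.sum_comm]
        simp only [Finset.sum_mul]
    _ ≤ _ := by
        -- Bessel for `x` and `z` bounds each weight by `1`; Bessel for the two rotating frames
        -- bounds the total weight by `k`.
        refine sum_mul_le_sum_natAdd ha hmono (fun j => by positivity) (fun j => ?_) ?_
        · have h1 := sum_inner_sq_le h.right_orthonormal (rotFrame v w a t j)
          have h2 := sum_inner_sq_le_of_pairwise_orthogonal hz1 hzo (rotFrame w (-v) a t j)
          rw [hu.norm_eq_one] at h1
          rw [hu'.norm_eq_one] at h2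
          rw [← Finset.sum_div, Finset.sum_add_distrib]
          simp only [real_inner_comm (x _)] at h1 ⊢
          linarith
        · rw [Finset.sum_comm]
          have : (k : ℝ) = ∑ _i : Fin k, (1 : ℝ) := by simp
          rw [this]
          refine Finset.sum_le_sum fun i _ => ?_
          have h1 := sum_inner_sq_le hu (x i)
          have h2 := sum_inner_sq_le hu' (z i)
          rw [h.right_orthonormal.norm_eq_one] at h1
          have h3 : ‖z i‖ ^ 2 ≤ 1 := pow_le_one₀ (norm_nonneg _) (hz1 i)
          rw [← Finset.sum_div, Finset.sum_add_distrib]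
          simp only [real_inner_comm (z _)] at h2
          linarith

theorem dampedAngleSum_rotSpan_one_le {m k : ℕ} {v w : Fin (m + k) → E} {a : Fin (m + k) → ℝ}
    (ha : ∀ j, 0 ≤ a j) (hmono : Monotone a)
    (hv : Orthonormal ℝ v) (hw : Orthonormal ℝ w) (hvw : ∀ i j, ⟪v i, w j⟫ = 0)
    {Y : Submodule ℝ E} [FiniteDimensional ℝ Y] (hY : finrank ℝ Y = k)
    {c : ℝ} (hc : 0 ≤ c) (hc1 : c < 1) :
    dampedAngleSum k c Y (rotSpan v w a 1) ≤
      dampedAngleSum k c Y (rotSpan v w a 0) + ∑ i : Fin k, a (Fin.natAdd m i) := by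
  have hk : k ≤ m + k := Nat.le_add_left k m
  refine le_add_of_touching_above
    (continuous_dampedAngleSum a hv hw hvw hk hY hc hc1.le) fun t => ?_
  have ht := (finrank_rotSpan a hv hw hvw t).ge
  obtain ⟨y, x, h⟩ := exists_isPrincipal Y (rotSpan v w a t) hY (hk.trans ht)
  refine ⟨_, _, hasDerivAt_sum_arccos_transport a hv hw hvw h hc hc1, ?_,
    dampedAngleSum_rotSpan_le a hv hw hvw hk h hc hc1.le,
    first_variation_le ha hmono hv hw hvw h hc hc1⟩
  rw [h.dampedAngleSum_eq (hk.trans ht)]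
  exact Finset.sum_congr rfl fun i _ => by
    rw [transport_self a hv hw hvw (h.right_mem i), h.inner_left_right_self]

end JordanAngles

/-! ### Triangle inequality for the Jordan angles -/

namespace JordanAngles

open Module Submodule Filter Topology
open scoped RealInnerProductSpace

variable {p q : ℕ}

theorem cosAngle_nonneg (L M : Gr p q) (j : Fin p) : 0 ≤ cosAngle L M j :=
  let ⟨_, _, h⟩ := exists_isPrincipal_cosAngle L M
  h.nonneg j

theorem cosAngle_le_one (L M : Gr p q) (j : Fin p) : cosAngle L M j ≤ 1 :=
  let ⟨_, _, h⟩ := exists_isPrincipal_cosAngle L M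
  h.le_one j

theorem cos_angle (L M : Gr p q) (j : Fin p) : Real.cos (angle L M j) = cosAngle L M j :=
  Real.cos_arccos (by linarith [cosAngle_nonneg L M j]) (cosAngle_le_one L M j)

theorem angle_nonneg (L M : Gr p q) (j : Fin p) : 0 ≤ angle L M j := Real.arccos_nonneg _

theorem angle_monotone (L M : Gr p q) : Monotone (angle L M) := by
  obtain ⟨_, _, h⟩ := exists_isPrincipal_cosAngle L M
  exact fun i j hij => Real.antitone_arccos (h.antitone hij)

theorem cosAngle_comm (L M : Gr p q) : cosAngle L M = cosAngle M L := by
  obtain ⟨_, _, h⟩ := exists_isPrincipal_cosAngle M L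
  exact cosAngle_eq (h.swap L.2)

theorem angle_comm (L M : Gr p q) : angle L M = angle M L := by
  unfold angle
  rw [cosAngle_comm]

theorem angle_self (L : Gr p q) : angle L L = 0 := by
  obtain ⟨e, _, h⟩ := exists_isPrincipal_cosAngle L L
  have h1 : IsPrincipal L.1 L.1 e e fun _ => 1 :=
    ⟨h.left_orthonormal, h.left_orthonormal, h.span_left, h.left_mem,
      fun _ _ _ => (one_mul _).symm, fun _ => zero_le_one, fun _ _ _ => le_rfl⟩
  ext j
  rw [angle, cosAngle_eq h1, Real.arccos_one, Pi.zero_apply]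

theorem eq_of_angle_eq_zero {L M : Gr p q} (h : angle L M = 0) : L = M := by
  obtain ⟨e, m, hem⟩ := exists_isPrincipal_cosAngle L M
  have he : e = m := by
    ext1 j
    have h1 := hem.inner_left_right_self j
    rw [← cos_angle, h, Pi.zero_apply, Real.cos_zero] at h1
    exact (inner_eq_one_iff_of_norm_eq_one (hem.left_orthonormal.norm_eq_one j)
      (hem.right_orthonormal.norm_eq_one j)).mp h1
  apply Subtype.ext
  rw [← hem.span_left, ← (hem.swap M.2).span_left, he]

/-- The points of the Grassmannian are joined by rotating frames with the Jordan angles as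
angular velocities. -/
theorem exists_rotSpan (hpq : p ≤ q) (M N : Gr p q) :
    ∃ v w : Fin p → Euc p q, Orthonormal ℝ v ∧ Orthonormal ℝ w ∧ (∀ i j, ⟪v i, w j⟫ = 0) ∧
      rotSpan v w (angle M N) 0 = M.1 ∧ rotSpan v w (angle M N) 1 = N.1 := by
  obtain ⟨e, n, h⟩ := exists_isPrincipal_cosAngle M N
  have h' := h.swap N.2
  set s : Fin p → ℝ := fun j => Real.sin (angle M N j)
  have hee := orthonormal_iff_ite.mp h.left_orthonormal
  have hnn := orthonormal_iff_ite.mp h.right_orthonormal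
  have hd : ∀ i j, ⟪n i - cosAngle M N i • e i, n j - cosAngle M N j • e j⟫ =
      if i = j then s i ^ 2 else 0 := by
    intro i j
    simp only [inner_sub_left, inner_sub_right, real_inner_smul_left, real_inner_smul_right,
      hee, hnn, h.inner_left_right, h'.inner_left_right]
    by_cases hij : i = j
    · subst hij
      simp only [if_true, s, Real.sin_sq, cos_angle]
      ring
    · simp [hij]
  have hfin : finrank ℝ (M.1ᗮ : Submodule ℝ (Euc p q)) = q := by
    have h1 := M.1.finrank_add_finrank_orthogonal
    rw [M.2, finrank_euclideanSpace_fin] at h1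
    omega
  have hs0 : ∀ j, 0 ≤ s j := fun j =>
    Real.sin_nonneg_of_nonneg_of_le_pi (angle_nonneg M N j) (Real.arccos_le_pi _)
  -- The normalized components of `n j` orthogonal to `M` are prescribed where the sine is nonzero.
  -- The other directions are arbitrary, and `p ≤ q` leaves room for them in the orthogonal
  -- complement.
  obtain ⟨w, hw, hwM, hws⟩ := exists_orthonormal_extension_mem (M.1ᗮ) (ι := Fin p)
    (by rw [hfin, Fintype.card_fin]; exact hpq)
    (fun j => (s j)⁻¹ • (n j - cosAngle M N j • e j)) {j | s j ≠ 0}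
    (by
      intro j hj
      have h1 : ‖n j - cosAngle M N j • e j‖ ^ 2 = s j ^ 2 := by
        rw [← real_inner_self_eq_norm_sq, hd, if_pos rfl]
      rw [norm_smul, (sq_eq_sq₀ (norm_nonneg _) (hs0 j)).mp h1, norm_inv,
        Real.norm_of_nonneg (hs0 j)]
      exact inv_mul_cancel₀ hj)
    (by
      intro i _ j _ hij
      rw [real_inner_smul_left, real_inner_smul_right, hd, if_neg hij, mul_zero, mul_zero])
    (by
      intro j
      refine smul_mem _ _ ((mem_orthogonal' _ _).mpr fun u hu => ?_)
      rw [inner_sub_left, real_inner_smul_left, h'.inner_eq j u hu, sub_self])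
  have hnw : ∀ j, n j = Real.cos (angle M N j) • e j + s j • w j := by
    intro j
    rw [cos_angle]
    by_cases hj : s j = 0
    · have h1 := hd j j
      rw [if_pos rfl, hj, sq, mul_zero, inner_self_eq_zero, sub_eq_zero] at h1
      rw [hj, zero_smul, add_zero, h1]
    · rw [hws j hj, smul_smul, mul_inv_cancel₀ hj, one_smul, add_sub_cancel]
  refine ⟨e, w, h.left_orthonormal, hw,
    fun i j => (mem_orthogonal _ _).mp (hwM j) _ (h.left_mem i), ?_, ?_⟩
  · have : rotFrame e w (angle M N) 0 = e := funext fun j => by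
      rw [rotFrame, mul_zero, Real.cos_zero, Real.sin_zero, one_smul, zero_smul, add_zero]
    rw [rotSpan, this, h.span_left]
  · have : rotFrame e w (angle M N) 1 = n := funext fun j => by
      rw [rotFrame, mul_one, hnw]
    rw [rotSpan, this, h'.span_left]

/-- The sums of the largest Jordan angles satisfy the triangle inequality. -/
theorem sum_angle_natAdd_le {m k : ℕ} (hq : m + k ≤ q) (L M N : Gr (m + k) q) :
    ∑ i : Fin k, angle L N (Fin.natAdd m i) ≤
      ∑ i : Fin k, angle L M (Fin.natAdd m i) + ∑ i : Fin k, angle M N (Fin.natAdd m i) := by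
  obtain ⟨v, w, hv, hw, hvw, hM, hN⟩ := exists_rotSpan hq M N
  obtain ⟨e, n, h⟩ := exists_isPrincipal_cosAngle L N
  obtain ⟨e', n', h'⟩ := exists_isPrincipal_cosAngle L M
  have hinj := Fin.natAdd_injective k m
  -- The principal vectors of `L` with the `k` smallest cosines against `N`: the angles between `Y`
  -- and `N` are exactly the `k` largest angles between `L` and `N`.
  set Y := span ℝ (Set.range fun i => e (Fin.natAdd m i))
  have hYL : Y ≤ L.1 := span_le.mpr (by rintro _ ⟨i, rfl⟩; exact h.left_mem _)
  have hYN : IsPrincipal Y N.1 (fun i => e (Fin.natAdd m i)) (fun i => n (Fin.natAdd m i))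
      fun i => cosAngle L N (Fin.natAdd m i) :=
    ⟨h.left_orthonormal.comp _ hinj, h.right_orthonormal.comp _ hinj, rfl, fun i => h.right_mem _,
      fun i => h.inner_eq _, fun i => h.nonneg _,
      fun i j hij => h.antitone (by rw [Fin.le_def] at hij ⊢; simpa using hij)⟩
  have hY := hYN.finrank_left
  have hrank : ∀ t, k ≤ finrank ℝ (rotSpan v w (angle M N) t) := fun t => by
    rw [finrank_rotSpan _ hv hw hvw]
    exact Nat.le_add_left k m
  obtain ⟨y, x, hYM⟩ := exists_isPrincipal Y (rotSpan v w (angle M N) 0) hY (hrank 0)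
  have key : ∀ c : ℝ, 0 ≤ c → c < 1 →
      ∑ i : Fin k, Real.arccos (c * cosAngle L N (Fin.natAdd m i)) ≤
        ∑ i : Fin k, Real.arccos (c * cosAngle L M (Fin.natAdd m i)) +
          ∑ i : Fin k, angle M N (Fin.natAdd m i) := by
    intro c hc hc1
    have h1 := dampedAngleSum_rotSpan_one_le (angle_nonneg M N) (angle_monotone M N) hv hw hvw
      hY hc hc1
    rw [IsPrincipal.dampedAngleSum_eq (hN.symm ▸ hYN) (hrank 1),
      hYM.dampedAngleSum_eq (hrank 0)] at h1
    refine h1.trans (add_le_add_left (Finset.sum_le_sum fun i _ => ?_) _)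
    refine Real.antitone_arccos (mul_le_mul_of_nonneg_left ?_ hc)
    -- Passing from `L` to `Y` can only raise the cosines against `M`, compared with the `k`
    -- smallest ones of `L`.
    exact hYM.interlacing (hM.symm ▸ h') hYL i (Fin.natAdd m i) (by simp; omega)
  have hcont : ∀ g : Fin k → ℝ, Tendsto (fun c : ℝ => ∑ i, Real.arccos (c * g i)) (𝓝[<] 1)
      (𝓝 (∑ i, Real.arccos (g i))) := by
    intro g
    have hc : Continuous fun c : ℝ => ∑ i, Real.arccos (c * g i) :=
      continuous_finsetSum _ fun i _ => Real.continuous_arccos.comp (by fun_prop)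
    have := hc.tendsto 1
    simp only [one_mul] at this
    exact this.mono_left nhdsWithin_le_nhds
  refine le_of_tendsto_of_tendsto (hcont fun i => cosAngle L N (Fin.natAdd m i))
    ((hcont fun i => cosAngle L M (Fin.natAdd m i)).add_const _) ?_
  filter_upwards [Ioo_mem_nhdsLT (zero_lt_one' ℝ)] with c hc
  exact key c hc.1.le hc.2

theorem sum_angle_ge_le (hpq : p ≤ q) (L M N : Gr p q) (n : ℕ) :
    0 ≤ ∑ i : Fin p, if n ≤ (i : ℕ) then angle L M i + angle M N i - angle L N i else 0 := by
  rcases le_or_gt n p with hn | hn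
  · obtain ⟨k, rfl⟩ := Nat.exists_eq_add_of_le hn
    have := sum_angle_natAdd_le hpq L M N
    rw [Fin.sum_univ_add]
    simp only [Fin.val_castAdd, Fin.val_natAdd, Nat.le_add_right, if_true,
      Finset.sum_sub_distrib, Finset.sum_add_distrib]
    have h0 : ∀ (i : Fin n) (r : ℝ), (if n ≤ (i : ℕ) then r else 0) = 0 := fun i r =>
      if_neg (by omega)
    simp only [h0, Finset.sum_const_zero]
    linarith
  · refine (Finset.sum_eq_zero fun i _ => if_neg ?_).ge
    omega

/-! ### Invariant norms and the metric -/

namespace IsWeylInvariantNorm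

variable {l : Seminorm ℝ (Fin p → ℝ)}

theorem map_perm (hl : IsWeylInvariantNorm l) (τ : Equiv.Perm (Fin p)) (x : Fin p → ℝ) :
    l (fun j => x (τ j)) = l x :=
  hl.invariant (LinearEquiv.funCongrLeft ℝ ℝ τ)
    (Subgroup.subset_closure (Or.inl ⟨τ, fun _ _ => rfl⟩)) x

theorem map_sign (hl : IsWeylInvariantNorm l) {σ : Fin p → ℝ} (hσ : ∀ j, σ j = 1 ∨ σ j = -1)
    (x : Fin p → ℝ) : l (fun j => σ j * x j) = l x := by
  have hσσ : ∀ j, σ j * σ j = 1 := fun j => by rcases hσ j with h | h <;> simp [h]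
  let f : (Fin p → ℝ) →ₗ[ℝ] (Fin p → ℝ) := LinearMap.pi fun j => σ j • LinearMap.proj j
  have hf : Function.Involutive f := fun x => by
    ext j
    simp [f, ← mul_assoc, hσσ]
  exact hl.invariant (LinearEquiv.ofInvolutive f hf)
    (Subgroup.subset_closure (Or.inr ⟨σ, hσ, fun _ _ => rfl⟩)) x

/-- A norming functional at an increasing vector can be chosen with increasing nonnegative
coefficients. -/
theorem exists_weights (hl : IsWeylInvariantNorm l) {x : Fin p → ℝ} (hx0 : ∀ j, 0 ≤ x j)
    (hx : Monotone x) :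
    ∃ w : Fin p → ℝ, (∀ j, 0 ≤ w j) ∧ Monotone w ∧ l x ≤ ∑ j, w j * x j ∧
      ∀ y, ∑ j, w j * y j ≤ l y := by
  by_cases hxz : x = 0
  · refine ⟨0, fun _ => le_rfl, fun _ _ _ => le_rfl, ?_, fun y => ?_⟩
    · simp [hxz]
    · simp
  -- Hahn–Banach: `f` is dominated by `l` and attains it at `x`. Its coefficients are then replaced
  -- by their absolute values in increasing order.
  obtain ⟨f, hf, hfl⟩ := exists_extension_of_le_sublinear
    (LinearPMap.mkSpanSingleton x (l x) hxz : (Fin p → ℝ) →ₗ.[ℝ] ℝ) l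
    (fun c hc y => by rw [map_smul_eq_mul, Real.norm_of_nonneg hc.le])
    (fun y z => map_add_le_add l y z) (by
      rintro ⟨y, hy⟩
      obtain ⟨c, rfl⟩ := mem_span_singleton.mp hy
      rw [LinearPMap.mkSpanSingleton'_apply]
      simp only [RingHom.id_apply, smul_eq_mul, map_smul_eq_mul]
      exact mul_le_mul_of_nonneg_right (le_abs_self c) (apply_nonneg l x))
  have hfx : f x = l x :=
    (hf ⟨x, mem_span_singleton_self x⟩).trans (LinearPMap.mkSpanSingleton'_apply_self _ _ _ _)
  set b : Fin p → ℝ := fun j => f (Pi.single j 1)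
  have hfb : ∀ y, f y = ∑ j, b j * y j := by
    intro y
    conv_lhs => rw [pi_eq_sum_univ' y, map_sum]
    refine Finset.sum_congr rfl fun j _ => ?_
    rw [map_smul, smul_eq_mul, mul_comm]
  set τ := Tuple.sort fun j => |b j|
  have hmono : Monotone fun j => |b (τ j)| := Tuple.monotone_sort fun j => |b j|
  refine ⟨fun j => |b (τ j)|, fun j => abs_nonneg _, hmono, ?_, fun y => ?_⟩
  -- Rearrangement: two increasing vectors have the largest pairing, so sorting the coefficients
  -- loses nothing at `x`.
  · have h1 := (hmono.monovary hx).sum_comp_perm_mul_le_sum_mul (σ := τ⁻¹)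
    refine le_trans ?_ h1
    rw [← hfx, hfb]
    refine Finset.sum_le_sum fun j _ => mul_le_mul_of_nonneg_right ?_ (hx0 j)
    simpa using le_abs_self (b j)
  · set ε : Fin p → ℝ := fun j => if 0 ≤ b j then 1 else -1
    have hε : ∀ j, ε j = 1 ∨ ε j = -1 := fun j => by
      simp only [ε]
      split_ifs <;> simp
    have hεb : ∀ j, b j * ε j = |b j| := fun j => by
      simp only [ε]
      split_ifs with h
      · rw [abs_of_nonneg h, mul_one]
      · rw [abs_of_neg (not_le.mp h), mul_neg_one]
    -- The permutation and the signs are moved from the coefficients to `y`, where `l` does not see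
    -- them.
    calc ∑ j, |b (τ j)| * y j = ∑ j, |b j| * y (τ⁻¹ j) := by
          rw [← Equiv.sum_comp τ fun j => |b j| * y (τ⁻¹ j)]
          simp
      _ = f fun j => ε j * y (τ⁻¹ j) := by
          rw [hfb]
          exact Finset.sum_congr rfl fun j _ => by rw [← mul_assoc, hεb]
      _ ≤ l fun j => ε j * y (τ⁻¹ j) := hfl _
      _ = l y := by rw [hl.map_sign hε fun j => y (τ⁻¹ j), hl.map_perm]

/-- The weights norm `angle L N` and are dominated by `l` on the other two angle vectors; being
increasing, they need only the inequalities for tail sums. -/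
theorem angle_triangle (hl : IsWeylInvariantNorm l) (hpq : p ≤ q) (L M N : Gr p q) :
    l (angle L N) ≤ l (angle L M) + l (angle M N) := by
  obtain ⟨w, hw, hmono, hwx, hwy⟩ := hl.exists_weights (angle_nonneg L N) (angle_monotone L N)
  have h := sum_mul_nonneg_of_sum_ge_nonneg w _ hw hmono (sum_angle_ge_le hpq L M N)
  simp only [mul_sub, mul_add, Finset.sum_sub_distrib, Finset.sum_add_distrib] at h
  linarith [hwy (angle L M), hwy (angle M N)]

/-- The metric on the Grassmannian that a norm of the Jordan angles defines. -/
abbrev metricSpace (hl : IsWeylInvariantNorm l) (hpq : p ≤ q) : MetricSpace (Gr p q) where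
  dist L M := l (angle L M)
  dist_self L := by rw [angle_self, map_zero]
  dist_comm L M := by rw [angle_comm]
  dist_triangle := hl.angle_triangle hpq
  eq_of_dist_eq_zero h := eq_of_angle_eq_zero (hl.eq_zero _ h)

end IsWeylInvariantNorm

/-! ### H-curves and minimal geodesics -/

theorem SufficientlyNear.mono {a : Fin p → ℝ} {s t u v : ℝ} (h : SufficientlyNear a s t)
    (ha : ∀ j, 0 ≤ a j) (huv : |u - v| ≤ |s - t|) : SufficientlyNear a u v :=
  fun j => (mul_le_mul_of_nonneg_left huv (ha j)).trans (h j)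

/-- The defining frames at `s` and `t` are already principal vectors: nearness keeps `a j * |s - t|`
in `[0, π / 2]`, where the cosine is nonnegative and decreasing, and `arccos` recovers the angle. -/
theorem IsHCurve.angle_eq {γ : ℝ → Gr p q} {a : Fin p → ℝ} (hγ : IsHCurve γ a) {s t : ℝ}
    (h : SufficientlyNear a s t) : angle (γ s) (γ t) = fun j => a j * |s - t| := by
  obtain ⟨b, rfl⟩ := hγ.eq_hCurve
  have hb := orthonormal_iff_ite.mp b.orthonormal
  have hv : Orthonormal ℝ fun j => b (Sum.inl j) :=
    b.orthonormal.comp _ Sum.inl_injective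
  have hw : Orthonormal ℝ fun j => b (Sum.inr (Sum.inl j)) :=
    b.orthonormal.comp _ (Sum.inr_injective.comp Sum.inl_injective)
  have hin := inner_rotFrame a hv hw fun i j => by simp [hb]
  have hcos : ∀ j, Real.cos (a j * (s - t)) = Real.cos (a j * |s - t|) := fun j => by
    rw [← Real.cos_abs, abs_mul, abs_of_nonneg (hγ.nonneg j)]
  have h0 : ∀ j, 0 ≤ a j * |s - t| := fun j => mul_nonneg (hγ.nonneg j) (abs_nonneg _)
  have hpr : IsPrincipal (hCurve b a s).1 (hCurve b a t).1 (hVector b a s) (hVector b a t)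
      fun j => Real.cos (a j * |s - t|) := by
    refine ⟨orthonormal_hVector b a s, orthonormal_hVector b a t, rfl,
      fun i => subset_span (Set.mem_range_self i), fun i v hv => ?_, fun j => ?_, ?_⟩
    · rw [real_inner_comm, inner_eq_sum_of_mem_span (orthonormal_hVector b a t) hv,
        Finset.sum_eq_single i, ← hcos, mul_comm]
      · congr 1
        rw [real_inner_comm]
        exact (hin s t i i).trans (if_pos rfl)
      · intro j _ hj
        rw [real_inner_comm (hVector b a s i), show ⟪hVector b a s i, hVector b a t j⟫ = 0 from
          (hin s t i j).trans (if_neg hj.symm), mul_zero]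
      · simp
    · exact Real.cos_nonneg_of_neg_pi_div_two_le_of_le (by linarith [h0 j, Real.pi_pos]) (h j)
    · intro i j hij
      exact Real.cos_le_cos_of_nonneg_of_le_pi (h0 i) (by linarith [h j, Real.pi_pos])
        (mul_le_mul_of_nonneg_right (hγ.mono hij) (abs_nonneg _))
  ext j
  rw [angle, cosAngle_eq hpr, Real.arccos_cos (h0 j) (by linarith [h j, Real.pi_pos])]

/-- Being `c`-Lipschitz, `γ` has length at most `c * (t - s)`, which is the distance of its end
points and so a lower bound for every competitor. -/
theorem isMinimalGeodesicOn_of_dist_eq {X : Type*} [MetricSpace X] {γ : ℝ → X} {c s t : ℝ}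
    (hc : 0 ≤ c) (hst : s ≤ t)
    (h : ∀ u ∈ Set.Icc s t, ∀ v ∈ Set.Icc s t, dist (γ u) (γ v) = c * |u - v|) :
    IsMinimalGeodesicOn γ c s t := by
  refine ⟨h, fun δ x y hxy _ hx hy => ?_⟩
  have hs : s ∈ Set.Icc s t := Set.left_mem_Icc.mpr hst
  have ht : t ∈ Set.Icc s t := Set.right_mem_Icc.mpr hst
  have hlip : LipschitzOnWith c.toNNReal γ (Set.Icc s t) :=
    LipschitzOnWith.of_dist_le_mul fun u hu v hv => by
      rw [h u hu v hv, Real.coe_toNNReal c hc, Real.dist_eq]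
  have h1 := hlip.comp_eVariationOn_le (Set.mapsTo_id _)
  have h2 := (monotoneOn_id (s := Set.Icc s t)).eVariationOn_eq hs ht
  rw [Set.inter_self] at h2
  calc eVariationOn γ (Set.Icc s t) ≤ c.toNNReal * ENNReal.ofReal (t - s) :=
        h1.trans (mul_le_mul_right h2.le _)
    _ = edist (γ s) (γ t) := by
        rw [edist_dist, h s hs t ht, abs_sub_comm, abs_of_nonneg (sub_nonneg.mpr hst),
          ENNReal.ofReal_mul hc]
        rfl
    _ = edist (δ x) (δ y) := by rw [hx, hy]
    _ ≤ _ := eVariationOn.edist_le δ (Set.left_mem_Icc.mpr hxy) (Set.right_mem_Icc.mpr hxy)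

theorem exists_pos_sufficientlyNear {a : Fin p → ℝ} (ha : ∀ j, 0 ≤ a j) :
    ∃ ε : ℝ, 0 < ε ∧ ∀ r, SufficientlyNear a (r - ε) (r + ε) := by
  have hS : 0 ≤ ∑ j, a j := Finset.sum_nonneg fun j _ => ha j
  -- The interval has length `2 * ε`, hence `π / 4`; the summand `1` covers the case of vanishing
  -- invariants.
  refine ⟨Real.pi / 4 / (∑ j, a j + 1), by positivity, fun r j => ?_⟩
  have hj : a j ≤ ∑ j, a j := Finset.single_le_sum (fun j _ => ha j) (Finset.mem_univ j)
  set ε := Real.pi / 4 / (∑ j, a j + 1) with hε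
  have hε0 : 0 ≤ ε := by positivity
  have h1 : (∑ j, a j + 1) * ε = Real.pi / 4 := by
    rw [hε]
    field_simp
  rw [show r - ε - (r + ε) = -(2 * ε) by ring, abs_neg, abs_of_nonneg (by positivity)]
  nlinarith

end JordanAngles

end

theorem corollary14 (p q : ℕ) (hp : 1 ≤ p) (hpq : p ≤ q) :
    (∀ (γ : ℝ → JordanAngles.Gr p q) (a : Fin p → ℝ), JordanAngles.IsHCurve γ a →
      ∀ s₁ s₂ s₃ : ℝ, s₁ < s₂ → s₂ < s₃ →
        JordanAngles.SufficientlyNear a s₁ s₂ → JordanAngles.SufficientlyNear a s₂ s₃ →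
        JordanAngles.SufficientlyNear a s₁ s₃ →
        ∀ j, JordanAngles.angle (γ s₁) (γ s₂) j + JordanAngles.angle (γ s₂) (γ s₃) j =
          JordanAngles.angle (γ s₁) (γ s₃) j) ∧
    ∀ l : Seminorm ℝ (Fin p → ℝ), JordanAngles.IsWeylInvariantNorm l →
      ∃ _ : MetricSpace (JordanAngles.Gr p q),
        (∀ L M : JordanAngles.Gr p q, dist L M = l (JordanAngles.angle L M)) ∧
        ∀ (γ : ℝ → JordanAngles.Gr p q) (a : Fin p → ℝ), JordanAngles.IsHCurve γ a →
          JordanAngles.IsGeodesic γ ∧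
          ∀ s t : ℝ, s ≤ t → JordanAngles.SufficientlyNear a s t →
            JordanAngles.IsMinimalGeodesicOn γ (l a) s t := by
  refine ⟨fun γ a hγ s₁ s₂ s₃ h12 h23 H12 H23 H13 j => ?_, fun l hl => ?_⟩
  · rw [hγ.angle_eq H12, hγ.angle_eq H23, hγ.angle_eq H13]
    simp only
    rw [abs_of_neg (sub_neg.mpr h12), abs_of_neg (sub_neg.mpr h23),
      abs_of_neg (sub_neg.mpr (h12.trans h23))]
    ring
  · let _ := hl.metricSpace hpq
    refine ⟨hl.metricSpace hpq, fun _ _ => rfl, fun γ a hγ => ?_⟩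
    have hmin : ∀ s t : ℝ, s ≤ t → JordanAngles.SufficientlyNear a s t →
        JordanAngles.IsMinimalGeodesicOn γ (l a) s t := by
      intro s t hst H
      refine JordanAngles.isMinimalGeodesicOn_of_dist_eq (apply_nonneg l a) hst
        fun u hu v hv => ?_
      have huv : |u - v| ≤ |s - t| := by
        rw [abs_sub_comm s t, abs_of_nonneg (sub_nonneg.mpr hst), abs_le]
        constructor <;> linarith [hu.1, hu.2, hv.1, hv.2]
      change l (JordanAngles.angle (γ u) (γ v)) = _
      rw [hγ.angle_eq (H.mono hγ.nonneg huv)]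
      have hsmul : (fun j => a j * |u - v|) = |u - v| • a := by
        ext j
        simp [mul_comm]
      rw [hsmul, map_smul_eq_mul, Real.norm_of_nonneg (abs_nonneg _), mul_comm]
    obtain ⟨ε, hε, hnear⟩ := JordanAngles.exists_pos_sufficientlyNear hγ.nonneg
    exact ⟨⟨l a, apply_nonneg l a, fun r =>
      ⟨ε, hε, hmin _ _ (by linarith) (hnear r)⟩⟩, hmin⟩
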